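/- Let $\mathcal N=(\mathcal P_v)_{v\in V}$ be an abelian network on a directed graph $G=(V,E)$ (loops allowed): each $\mathcal P_v$ has an input alphabet $A_v$, a state space $Q_v$, commuting transition maps $t_a:Q_v\to Q_v$ ($a\in A_v$), and message passing functions $o_a^u:Q_v\to A_u^*$ for $a\in A_v$, $(v,u)\in E$, such that input words equal up to permutation, read in the same initial state, produce output words equal up to permutation on each edge. Put $A=\bigsqcup_v A_v$ and $Q=\prod_v Q_v$. Assume that $\mathcal N$ is * finite: $V$, all $A_v$ and all $Q_v$ are finite; * irreducible: for each $v$, $Q_v\neq\emptyset$ and for all $q,q'\in Q_v$ there are $m,m'$ in the local monoid $M_v=\langle t_a\rangle_{a\in A_v}\subset \mathrm{End}(Q_v)$ with $mq=m'q'$; * halting on all inputs: for all $\mathbf x\in\mathbb N^A$, $\mathbf q\in Q$ there is a finite complete legal execution for $\mathbf x.\mathbf q$, i.e. a sequence of letters that can be processed one after the other, each being present among the waiting letters when it is processed, after which no letter is waiting. Write $\mathbf x\triangleright\triangleright\mathbf q$ for the state of the network after a complete legal execution for $\mathbf x.\mathbf q$ (it does not depend on the execution), let $\tau_a(\mathbf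 q)=1_a\triangleright\triangleright\mathbf q$, and let $M=\langle\tau_a\rangle_{a\in A}\subset\mathrm{End}(Q)$, a finite commutative monoid. The minimal idempotent of a finite commutative monoid is the product of all its idempotents. Let $e$ be that of $M$ and $e_v$ that of $M_v$. Let $\mathrm{Crit}\,\mathcal N=eM$ be the critical group and $\mathrm{Rec}\,\mathcal N=\{\mathbf q\in Q: e\mathbf q=\mathbf q\}$ the set of recurrent states. The maps $t_a$, $a\in A_v$, are commuting permutations of $e_vQ_v$; let $K_v$ be the kernel of the resulting action of $\mathbb Z^{A_v}$ on $e_vQ_v$, and let $K=\prod_v K_v\subset\mathbb Z^A$ be the total kernel. For $a\in A$ let $r_a=\min\{m\ge1: m1_a\in K\}$, and let $D$ be the diagonal $A\times A$ matrix with entries $r_a$. A state $\mathbf q\in Q$ is locally recurrent if $\mathbf q_v\in e_vQ_v$ for all $v$. For such $\mathbf q$ and $\mathbf k\in K\cap\mathbb N^A$, processing exactly $\mathbf k_a$ letters $a$ for each $a\in A$ in state $\mathbf q$ returns the network to $\mathbf q$; let $P(\mathbf k)\in\mathbb N^A$ count the letters of each type passed. The production matrix $P$ is the rational $A\times A$ matrix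 whose column $a$ is $P(1_a)=\frac1{r_a}P(r_a1_a)$; it is the same for all locally recurrent $\mathbf q$. Let $L=(I-P)D$ be the Laplacian and $\iota=[K:D\mathbb Z^A]$ the index of $D\mathbb Z^A$ in $K$. Then $$\#\mathrm{Rec}\,\mathcal N=\#\mathrm{Crit}\,\mathcal N=\frac{\det L}{\iota}.$$ -/

import Mathlib

noncomputable section

/-! ### Monoids of self-maps of a finite set -/

namespace EndAction

instance instFiniteEnd {X : Type*} [Finite X] : Finite (Function.End X) :=
  inferInstanceAs (Finite (X → X))

/-- The action of the monoid `M` of self-maps of `X` is irreducible: the relation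
`x ∼ y ↔ ∃ m m' ∈ M, m x = m' y` has exactly one equivalence class. -/
def IsIrreducible {X : Type*} (M : Submonoid (Function.End X)) : Prop :=
  Nonempty X ∧ ∀ x y : X, ∃ m ∈ M, ∃ m' ∈ M, m • x = m' • y

/-- The minimal idempotent `e = ∏ f`, the product of all idempotents `f` of `M`. The order of the
factors is irrelevant when `M` is commutative, which is the only case of interest. -/
def minIdem {X : Type*} [Finite X] (M : Submonoid (Function.End X)) : Function.End X :=
  (Set.toFinite {f : Function.End X | f ∈ M ∧ f * f = f}).toFinset.toList.prod

/-- The set `e X = {x | e x = x}`, where `e` is the minimal idempotent. -/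
def recurrentSet {X : Type*} [Finite X] (M : Submonoid (Function.End X)) : Set X :=
  {x | minIdem M • x = x}

/-- The set `e M`, where `e` is the minimal idempotent. -/
def minIdeal {X : Type*} [Finite X] (M : Submonoid (Function.End X)) : Set (Function.End X) :=
  {g | ∃ m ∈ M, g = minIdem M * m}

theorem exists_pow_idem {G : Type*} [Monoid G] [Finite G] (m : G) :
    ∃ j : ℕ, m ^ (j + 1) * m ^ (j + 1) = m ^ (j + 1) := by
  obtain ⟨a, b, hab, h⟩ := Finite.exists_ne_map_eq_of_infinite (fun n : ℕ => m ^ (n + 1))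
  wlog hlt : a < b generalizing a b
  · exact this b a hab.symm h.symm (by omega)
  obtain ⟨d, rfl⟩ := Nat.exists_eq_add_of_lt hlt
  have key : ∀ k i : ℕ, m ^ (a + 1 + i) = m ^ (a + 1 + i + k * (d + 1)) := by
    intro k
    induction k with
    | zero => simp
    | succ k ih =>
      intro i
      rw [ih i]
      have h' : m ^ (a + 1) = m ^ (a + 1 + (d + 1)) := by
        simpa [add_assoc, add_comm, add_left_comm] using h
      rw [show a + 1 + i + k * (d + 1) = (a + 1) + (i + k * (d + 1)) by ring, pow_add, h',
        ← pow_add]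
      congr 1
      ring
  refine ⟨(a + 1) * (d + 1) - 1, ?_⟩
  have h1 : (a + 1) * (d + 1) - 1 + 1 = (a + 1) + (a + 1) * d := by
    have : (a + 1) * (d + 1) = (a + 1) + (a + 1) * d := by ring
    omega
  rw [← pow_add, h1]
  have := key (a + 1) ((a + 1) * d)
  rw [this]
  congr 1
  ring

variable {X : Type*} [Finite X] {M : Submonoid (Function.End X)}

theorem minIdem_mem : minIdem M ∈ M :=
  M.list_prod_mem fun f hf => by
    simp only [Finset.mem_toList, Set.Finite.mem_toFinset, Set.mem_ofPred_eq] at hf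
    exact hf.1

theorem list_prod_idem {G : Type*} [Monoid G] (l : List G)
    (hc : ∀ f ∈ l, ∀ g ∈ l, f * g = g * f) (hi : ∀ f ∈ l, f * f = f) :
    l.prod * l.prod = l.prod ∧ ∀ f ∈ l, l.prod * f = l.prod := by
  induction l with
  | nil => simp
  | cons a l ih =>
    have ih' := ih (fun f hf g hg => hc f (by simp [hf]) g (by simp [hg]))
      (fun f hf => hi f (by simp [hf]))
    have hal : Commute a l.prod := by
      apply Commute.list_prod_right
      intro g hg
      exact hc a (by simp) g (by simp [hg])
    have ha := hi a (by simp)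
    refine ⟨?_, ?_⟩
    · rw [List.prod_cons, hal.symm.mul_mul_mul_comm, ha, ih'.1]
    · intro f hf
      rw [List.prod_cons]
      rcases List.mem_cons.1 hf with rfl | hf
      · rw [mul_assoc, ← hal.eq, ← mul_assoc, ha]
      · rw [mul_assoc, ih'.2 f hf]

/-- In a finite commutative monoid `e` is an idempotent accessible from every element. -/
theorem minIdem_spec (hc : ∀ f ∈ M, ∀ g ∈ M, f * g = g * f) :
    minIdem M * minIdem M = minIdem M ∧
      ∀ m ∈ M, ∃ m' ∈ M, m' * m = minIdem M := by
  have h := list_prod_idem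
    (Set.toFinite {f : Function.End X | f ∈ M ∧ f * f = f}).toFinset.toList
    (fun f hf g hg => by
      simp only [Finset.mem_toList, Set.Finite.mem_toFinset, Set.mem_ofPred_eq] at hf hg
      exact hc f hf.1 g hg.1)
    (fun f hf => by
      simp only [Finset.mem_toList, Set.Finite.mem_toFinset, Set.mem_ofPred_eq] at hf
      exact hf.2)
  refine ⟨h.1, fun m hm => ?_⟩
  obtain ⟨j, hj⟩ := exists_pow_idem m
  refine ⟨minIdem M * m ^ j, M.mul_mem minIdem_mem (M.pow_mem hm j), ?_⟩
  rw [mul_assoc, ← pow_succ]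
  exact h.2 _ (by
    simp only [Finset.mem_toList, Set.Finite.mem_toFinset, Set.mem_ofPred_eq]
    exact ⟨M.pow_mem hm _, hj⟩)

end EndAction

/-! ### Abelian processors -/

/-- The output word that results from processing the input word `w` in state `q`. -/
def outputWord {I Q B : Type*} (t : I → Function.End Q) (o : I → Q → List B) :
    List I → Q → List B
  | [], _ => []
  | a :: w, q => o a q ++ outputWord t o w (t a • q)

/-- An abelian processor with input alphabet `I`, state space `Q` and output alphabets
`(B u)_{u ∈ U}`. -/
structure AbelianProcessor (I Q : Type*) {U : Type*} (B : U → Type*) where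
  /-- the state transitions -/
  t : I → Function.End Q
  /-- the message passing functions -/
  o : I → (u : U) → Q → List (B u)
  t_comm : ∀ a b : I, t a * t b = t b * t a
  o_perm : ∀ (q : Q) (w w' : List I), w.Perm w' → ∀ u : U,
    (outputWord t (fun a => o a u) w q).Perm (outputWord t (fun a => o a u) w' q)

namespace AbelianProcessor

open EndAction

variable {I Q U : Type*} {B : U → Type*} (p : AbelianProcessor I Q B)

/-- The transition monoid `⟨t_a⟩`. -/
def monoid : Submonoid (Function.End Q) := Submonoid.closure (Set.range p.t)

theorem monoid_comm : ∀ f ∈ p.monoid, ∀ g ∈ p.monoid, f * g = g * f := by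
  have h : ∀ x ∈ Set.range p.t, ∀ y ∈ Set.range p.t, x * y = y * x := by
    rintro _ ⟨a, rfl⟩ _ ⟨b, rfl⟩
    exact p.t_comm a b
  intro f hf g hg
  have := (Submonoid.isMulCommutative_closure _ h).is_comm.comm ⟨f, hf⟩ ⟨g, hg⟩
  exact congrArg Subtype.val this

theorem t_mem (a : I) : p.t a ∈ p.monoid := Submonoid.subset_closure ⟨a, rfl⟩

variable [Finite Q]

theorem t_smul_mem (a : I) (q : recurrentSet p.monoid) :
    p.t a • (q : Q) ∈ recurrentSet p.monoid := by
  have hq : minIdem p.monoid • (q : Q) = q := q.2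
  change minIdem p.monoid • (p.t a • (q : Q)) = p.t a • (q : Q)
  rw [← mul_smul, p.monoid_comm _ minIdem_mem _ (p.t_mem a), mul_smul, hq]

theorem t_bijective (a : I) : Function.Bijective
    (fun q : recurrentSet p.monoid =>
      (⟨p.t a • (q : Q), p.t_smul_mem a q⟩ : recurrentSet p.monoid)) := by
  rw [← Finite.injective_iff_bijective]
  intro q q' h
  have h' : p.t a • (q : Q) = p.t a • (q' : Q) := congrArg Subtype.val h
  obtain ⟨m, -, hm⟩ := (minIdem_spec p.monoid_comm).2 _ (p.t_mem a)
  have hq : minIdem p.monoid • (q : Q) = q := q.2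
  have hq' : minIdem p.monoid • (q' : Q) = q' := q'.2
  apply Subtype.ext
  rw [← hq, ← hq', ← hm, mul_smul, mul_smul, h']

/-- The permutation of `e Q` given by `t_a`. -/
def perm (a : I) : Equiv.Perm (recurrentSet p.monoid) := Equiv.ofBijective _ (p.t_bijective a)

theorem perm_commute (a b : I) : Commute (p.perm a) (p.perm b) := by
  ext q
  change p.t a • (p.t b • (q : Q)) = p.t b • (p.t a • (q : Q))
  rw [← mul_smul, p.t_comm, mul_smul]

/-- The action of the group `ℤ^I` on `e Q` in which the basis vector `1_a` acts by `t_a`. -/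
def intAction [Fintype I] : (I → ℤ) →+ Additive (Equiv.Perm (recurrentSet p.monoid)) :=
  AddMonoidHom.noncommPiCoprod
    (fun a => zmultiplesHom (Additive (Equiv.Perm (recurrentSet p.monoid)))
      (Additive.ofMul (p.perm a)))
    (fun a b _ m n => by
      have h : AddCommute (Additive.ofMul (p.perm a)) (Additive.ofMul (p.perm b)) :=
        congrArg Additive.ofMul (p.perm_commute a b)
      exact (h.zsmul_left m).zsmul_right n)

/-- The kernel of the action of `ℤ^I` on `e Q`. -/
def kernel [Fintype I] : AddSubgroup (I → ℤ) := p.intAction.ker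

end AbelianProcessor

/-! ### Abelian networks -/

/-- An abelian network on the directed graph `G` with alphabets `A v` and state spaces `Q v`: at
each vertex `v` an abelian processor with one output alphabet `A u` for each edge `(v, u)`. -/
structure AbelianNetwork {V : Type*} (G : Digraph V) (A Q : V → Type*) where
  proc : (v : V) → AbelianProcessor (A v) (Q v) (fun u : {u : V // G.Adj v u} => A u)

namespace AbelianNetwork

open EndAction

/-- The total alphabet `A = ⊔ A_v`. -/
abbrev Letter {V : Type*} (A : V → Type*) := Σ v, A v

/-- A pair `x.q`, consisting of `x ∈ ℤ^A` and a state `q ∈ ∏ Q_v`. -/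
abbrev Config {V : Type*} (A Q : V → Type*) := (Letter A → ℤ) × ((v : V) → Q v)

variable {V : Type*} {G : Digraph V} {A Q : V → Type*}
variable [DecidableEq V] [∀ v, DecidableEq (A v)]
variable (N : AbelianNetwork G A Q)

open Classical in
/-- The number of letters `b` that are sent when the letter `a` is processed in state `q`. -/
def sent (a : Letter A) (q : (v : V) → Q v) (b : Letter A) : ℕ :=
  if h : G.Adj a.1 b.1 then ((N.proc a.1).o a.2 ⟨b.1, h⟩ (q a.1)).count b.2 else 0

/-- Process the letter `a`. -/
def step (c : Config A Q) (a : Letter A) : Config A Q :=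
  (fun b => c.1 b - (if b = a then 1 else 0) + (N.sent a c.2 b : ℤ),
    Function.update c.2 a.1 ((N.proc a.1).t a.2 • c.2 a.1))

/-- The result `π_w(x.q)` of the execution `w`. -/
def exec (w : List (Letter A)) (c : Config A Q) : Config A Q := w.foldl N.step c

/-- The execution `w` is legal for `x.q`. -/
def Legal : List (Letter A) → Config A Q → Prop
  | [], _ => True
  | a :: w, c => 1 ≤ c.1 a ∧ Legal w (N.step c a)

/-- The execution `w` is complete for `x.q`. -/
def Complete (w : List (Letter A)) (c : Config A Q) : Prop := ∀ a, (N.exec w c).1 a ≤ 0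

/-- The network halts on input `x.q`. -/
def HaltsOn (c : Config A Q) : Prop := ∃ w, N.Legal w c ∧ N.Complete w c

/-- The pair `x.q` for `x ∈ ℕ^A`. -/
def input (x : Letter A → ℕ) (q : (v : V) → Q v) : Config A Q := (fun a => (x a : ℤ), q)

/-- The network halts on all inputs. -/
def HaltsOnAllInputs : Prop := ∀ (x : Letter A → ℕ) (q : (v : V) → Q v), N.HaltsOn (input x q)

open Classical in
/-- The final state `x ▷▷ q` of a complete legal execution for `x.q` (if there is no such execution,
the value is `q`). -/
def globalAct (x : Letter A → ℕ) (q : (v : V) → Q v) : (v : V) → Q v :=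
  if h : N.HaltsOn (input x q) then (N.exec h.choose (input x q)).2 else q

/-- The map `τ_a : q ↦ 1_a ▷▷ q`. -/
def tau (a : Letter A) : Function.End ((v : V) → Q v) := fun q => N.globalAct (Pi.single a 1) q

/-- The global monoid `M = ⟨τ_a⟩`. -/
def globalMonoid : Submonoid (Function.End ((v : V) → Q v)) :=
  Submonoid.closure (Set.range N.tau)

/-- The network is irreducible: each of its processors is. -/
def IsIrreducible : Prop := ∀ v, EndAction.IsIrreducible (N.proc v).monoid

variable [Fintype V] [∀ v, Fintype (A v)] [∀ v, Finite (Q v)]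

/-- The set `Crit N = e M` underlying the critical group. -/
def Crit : Set (Function.End ((v : V) → Q v)) := minIdeal N.globalMonoid

/-- The set `Rec N` of recurrent states, those with `q = e q`. -/
def Rec : Set ((v : V) → Q v) := recurrentSet N.globalMonoid

/-- The state `q` is locally recurrent: `q_v ∈ e_v Q_v` for all `v`. -/
def IsLocallyRecurrent (q : (v : V) → Q v) : Prop :=
  ∀ v, q v ∈ recurrentSet (N.proc v).monoid

/-- An irreducible network has a locally recurrent state. -/
theorem exists_isLocallyRecurrent (h : N.IsIrreducible) : ∃ q, N.IsLocallyRecurrent q := by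
  refine ⟨fun v => minIdem (N.proc v).monoid • (h v).1.some, fun v => ?_⟩
  change minIdem (N.proc v).monoid • (minIdem (N.proc v).monoid • _) = _
  rw [← mul_smul, (minIdem_spec (N.proc v).monoid_comm).1]

/-- The restriction `ℤ^A → ℤ^{A_v}`. -/
def restrict (A : V → Type*) (v : V) : (Letter A → ℤ) →+ (A v → ℤ) where
  toFun x a := x ⟨v, a⟩
  map_zero' := rfl
  map_add' _ _ := rfl

/-- The total kernel `K = ∏ K_v`. -/
def totalKernel : AddSubgroup (Letter A → ℤ) :=
  ⨅ v, (N.proc v).kernel.comap (restrict A v)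

/-- A word in which each letter `a` occurs `x a` times. -/
def wordOf (x : Letter A → ℕ) : List (Letter A) :=
  Finset.univ.toList.flatMap fun a => List.replicate (x a) a

/-- The local action `x ▷ q = π_x(x.q)`. -/
def localAct (x : Letter A → ℕ) (q : (v : V) → Q v) : Config A Q := N.exec (wordOf x) (input x q)

/-- The production `P_q(k)`, where `k ▷ q = P_q(k).q` for `k ∈ K ∩ ℕ^A` and `q` locally
recurrent. -/
def production (q : (v : V) → Q v) (k : Letter A → ℕ) : Letter A → ℤ := (N.localAct k q).1

/-- The reset number `r_a = min {m ≥ 1 : m 1_a ∈ K}`. -/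
def resetNumber (a : Letter A) : ℕ := sInf {m : ℕ | 1 ≤ m ∧ Pi.single a (m : ℤ) ∈ N.totalKernel}

theorem resetNumber_spec (a : Letter A) :
    1 ≤ N.resetNumber a ∧ Pi.single a (N.resetNumber a : ℤ) ∈ N.totalKernel := by
  refine Nat.sInf_mem (s := {m : ℕ | 1 ≤ m ∧ Pi.single a (m : ℤ) ∈ N.totalKernel}) ?_
  let F : V → Type _ := fun v => Equiv.Perm (recurrentSet (N.proc v).monoid)
  refine ⟨∏ v, Nat.card (F v), Finset.prod_pos fun v _ => Nat.card_pos, ?_⟩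
  have hs : Pi.single a ((∏ v, Nat.card (F v) : ℕ) : ℤ) =
      (∏ v, Nat.card (F v)) • (Pi.single a 1 : Letter A → ℤ) := by
    rw [← Pi.single_smul]
    simp
  rw [hs]
  refine (AddSubgroup.mem_iInf).2 fun v => ?_
  rw [AddSubgroup.mem_comap, map_nsmul]
  change (N.proc v).intAction _ = 0
  rw [map_nsmul]
  obtain ⟨d, hd⟩ := Finset.dvd_prod_of_mem (fun v => Nat.card (F v)) (Finset.mem_univ v)
  rw [hd, mul_comm, mul_nsmul']
  have : Nat.card (F v) = Nat.card (Additive (F v)) := rfl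
  rw [this, card_nsmul_eq_zero', nsmul_zero]

/-- The production matrix: the column of the letter `a` is
`P_q(1_a) = (1 / r_a) P_q(r_a 1_a)`. -/
def productionMatrix (q : (v : V) → Q v) : Matrix (Letter A) (Letter A) ℚ :=
  Matrix.of fun b a =>
    (1 / (N.resetNumber a : ℚ)) * (N.production q (Pi.single a (N.resetNumber a)) b : ℚ)

/-- The Laplacian `L = (I - P) D`. -/
def laplacian (q : (v : V) → Q v) : Matrix (Letter A) (Letter A) ℚ :=
  (1 - N.productionMatrix q) * Matrix.diagonal fun a => (N.resetNumber a : ℚ)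

/-- The rectangular lattice `D ℤ^A`. -/
def rectLattice : AddSubgroup (Letter A → ℤ) :=
  (LinearMap.range (Matrix.mulVecLin
    (Matrix.diagonal fun a : Letter A => (N.resetNumber a : ℤ)))).toAddSubgroup

/-- The index `ι = [K : D ℤ^A]`. -/
def iota : ℕ := N.rectLattice.relIndex N.totalKernel

end AbelianNetwork

end

/-! Stabilizing after each added letter makes the whole network one commutative action of `A` on the
product of the `Q v`, and this action is again irreducible (`isIrreducible_globalProcessor`). For
any irreducible action the monoid is transitive on recurrent states, and by commutativity an element
of `eM` is determined by its value at one of them. Hence Rec and Crit are equinumerous, and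
orbit-stabilizer gives #Rec as the index in `ℤ^A` of the kernel of the global action
(`index_kernel`).

That kernel equals `(I - P)K` (`map_kernel_globalProcessor`). Processing `k ∈ K` at a locally
recurrent state restores the state and replaces the letters `k` by `Pk`, so `k` and `Pk` act alike.
Conversely, if two inputs lead to the same state, the letter counts of their executions differ by
some `k ∈ K`, and the inputs themselves differ by `(I - P)k`.

Since `I - P` is injective, it carries `Dℤ^A ≤ K` to `Lℤ^A ≤ (I - P)K` with the same index `ι`, so
`ι · #Rec = |det L|`. The sign comes from halting (`det_intLaplacian_pos`): `L` has nonpositive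
off-diagonal entries, and a halting execution yields some `c ≥ 0` with `Lc > 0`. -/

noncomputable section

/-! ### Determinants -/

namespace Matrix

/-- A strictly row diagonally dominant real matrix with positive diagonal has positive
determinant. -/
theorem det_pos_of_sum_row_lt_diag {n : Type*} [Fintype n] [DecidableEq n] (M : Matrix n n ℝ)
    (h : ∀ k, ∑ j ∈ Finset.univ.erase k, |M k j| < M k k) : 0 < M.det := by
  -- The segment from the identity to `M` stays strictly diagonally dominant, so the determinant
  -- cannot change sign along it.
  have hne : ∀ t ∈ Set.Icc (0 : ℝ) 1, ((1 - t) • (1 : Matrix n n ℝ) + t • M).det ≠ 0 := by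
    rintro t ⟨ht0, ht1⟩
    apply det_ne_zero_of_sum_row_lt_diag
    intro k
    have h1 : ∑ j ∈ Finset.univ.erase k, ‖((1 - t) • (1 : Matrix n n ℝ) + t • M) k j‖ =
        t * ∑ j ∈ Finset.univ.erase k, |M k j| := by
      rw [Finset.mul_sum]
      refine Finset.sum_congr rfl fun j hj => ?_
      have : k ≠ j := fun h => by simp [h] at hj
      simp [this, abs_of_nonneg ht0]
    have h2 : 0 ≤ ∑ j ∈ Finset.univ.erase k, |M k j| :=
      Finset.sum_nonneg fun _ _ => abs_nonneg _
    have h3 := h k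
    have h4 : ((1 - t) • (1 : Matrix n n ℝ) + t • M) k k = (1 - t) + t * M k k := by simp
    rw [h1, h4, Real.norm_eq_abs]
    refine lt_of_lt_of_le ?_ (le_abs_self _)
    rcases ht0.eq_or_lt with rfl | ht
    · simp
    · nlinarith
  have hcont : ContinuousOn (fun t : ℝ => ((1 - t) • (1 : Matrix n n ℝ) + t • M).det)
      (Set.Icc 0 1) := by
    apply Continuous.continuousOn
    fun_prop
  by_contra hle
  push Not at hle
  have hmem : (0 : ℝ) ∈ Set.Icc ((fun t : ℝ => ((1 - t) • (1 : Matrix n n ℝ) + t • M).det) 1)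
      ((fun t : ℝ => ((1 - t) • (1 : Matrix n n ℝ) + t • M).det) 0) := by
    constructor <;> simp [hle]
  obtain ⟨t, ht, h0⟩ := intermediate_value_Icc' zero_le_one hcont hmem
  exact hne t ht h0

/-- A real matrix whose off-diagonal entries are nonpositive and which maps some nonnegative vector
to a positive vector has positive determinant. -/
theorem det_pos_of_mulVec_pos {n : Type*} [Fintype n] [DecidableEq n] (M : Matrix n n ℝ)
    (hM : ∀ i j, i ≠ j → M i j ≤ 0) (c : n → ℝ) (hc' : ∀ i, 0 ≤ c i)
    (h : ∀ i, 0 < (M *ᵥ c) i) : 0 < M.det := by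
  have hc : ∀ i, 0 < c i := by
    refine fun i => (hc' i).lt_of_ne fun h0 => (h i).not_ge ?_
    rw [mulVec, dotProduct]
    refine Finset.sum_nonpos fun j _ => ?_
    rcases eq_or_ne i j with rfl | hij
    · rw [← h0, mul_zero]
    · exact mul_nonpos_of_nonpos_of_nonneg (hM i j hij) (hc' j)
  -- Scaling the columns by `c` turns `Mc > 0` into strict row dominance.
  have hpos : 0 < (M * diagonal c).det := by
    apply det_pos_of_sum_row_lt_diag
    intro k
    have h1 : ∑ j ∈ Finset.univ.erase k, |(M * diagonal c) k j| =
        - ∑ j ∈ Finset.univ.erase k, M k j * c j := by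
      rw [← Finset.sum_neg_distrib]
      refine Finset.sum_congr rfl fun j hj => ?_
      have hkj : k ≠ j := fun h => by simp [h] at hj
      rw [mul_diagonal, abs_of_nonpos (mul_nonpos_of_nonpos_of_nonneg (hM k j hkj) (hc j).le)]
    have h2 := h k
    rw [mulVec, dotProduct, ← Finset.add_sum_erase _ _ (Finset.mem_univ k)] at h2
    rw [h1, mul_diagonal]
    linarith
  rw [det_mul, det_diagonal] at hpos
  exact pos_of_mul_pos_left hpos (Finset.prod_nonneg fun i _ => (hc i).le)

/-- The index of the lattice spanned by the columns of an integer matrix. -/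
theorem index_range_mulVecLin {n : Type*} [Fintype n] [DecidableEq n] (T : Matrix n n ℤ)
    (hT : T.det ≠ 0) : (LinearMap.range T.mulVecLin).toAddSubgroup.index = T.det.natAbs := by
  have hinj : Function.Injective T.mulVecLin := by
    rw [injective_iff_map_eq_zero]
    intro v hv
    exact eq_zero_of_mulVec_eq_zero hT hv
  have h := Submodule.natAbs_det_equiv (LinearMap.range T.mulVecLin)
    (LinearEquiv.ofInjective T.mulVecLin hinj)
  have hcomp : (LinearMap.range T.mulVecLin).subtype ∘ₗ AddMonoidHom.toIntLinearMap
      ((LinearEquiv.ofInjective T.mulVecLin hinj : _ ≃ₗ[ℤ] _) :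
        (n → ℤ) →+ LinearMap.range T.mulVecLin) = Matrix.toLin' T := by
    ext; rfl
  rw [hcomp, LinearMap.det_toLin'] at h
  exact h.symm

end Matrix

/-! ### Irreducible abelian processors -/

/-- The state reached from `q` by processing the word `w`. -/
def runWord {I Q : Type*} (t : I → Function.End Q) (w : List I) (q : Q) : Q :=
  w.foldl (fun q a => t a • q) q

theorem Int.count_cons_fun {I : Type*} [DecidableEq I] (a : I) (w : List I) :
    (fun b => ((a :: w).count b : ℤ)) = (fun b => (w.count b : ℤ)) + Pi.single a 1 := by
  ext b
  rcases eq_or_ne a b with rfl | h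
  · simp
  · simp [h]

namespace AbelianProcessor

open EndAction

variable {I Q U : Type*} {B : U → Type*} (p : AbelianProcessor I Q B)

theorem exists_runWord_of_mem {m : Function.End Q} (hm : m ∈ p.monoid) :
    ∃ w : List I, ∀ q, m • q = runWord p.t w q := by
  induction hm using Submonoid.closure_induction with
  | mem x hx =>
    obtain ⟨a, rfl⟩ := hx
    exact ⟨[a], fun q => rfl⟩
  | one => exact ⟨[], fun q => rfl⟩
  | mul x y _ _ hx hy =>
    obtain ⟨w, hw⟩ := hx
    obtain ⟨w', hw'⟩ := hy
    exact ⟨w' ++ w, fun q => by rw [mul_smul, hw', hw]; simp [runWord]⟩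

theorem runWord_perm {w w' : List I} (h : w.Perm w') (q : Q) :
    runWord p.t w q = runWord p.t w' q := by
  refine h.foldl_eq' (fun a _ b _ q => ?_) q
  rw [← mul_smul, p.t_comm, mul_smul]

theorem runWord_smul {m : Function.End Q} (hm : m ∈ p.monoid) (w : List I) (q : Q) :
    runWord p.t w (m • q) = m • runWord p.t w q := by
  induction w generalizing q with
  | nil => rfl
  | cons a w ih =>
    change runWord p.t w (p.t a • (m • q)) = m • runWord p.t w (p.t a • q)
    rw [← ih, ← mul_smul, ← mul_smul, p.monoid_comm _ (p.t_mem a) m hm]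

variable [Finite Q]

theorem minIdem_smul_mem (q : Q) : minIdem p.monoid • q ∈ recurrentSet p.monoid := by
  change minIdem p.monoid • (minIdem p.monoid • q) = _
  rw [← mul_smul, (minIdem_spec p.monoid_comm).1]

/-- The transition monoid of an irreducible processor is transitive on the recurrent states. -/
theorem exists_smul_eq (h : IsIrreducible p.monoid) (q : Q) {q' : Q}
    (hq' : q' ∈ recurrentSet p.monoid) : ∃ m ∈ p.monoid, m • q = q' := by
  obtain ⟨m, hm, m', hm', hmm⟩ := h.2 q q'
  obtain ⟨n, hn, hne⟩ := (minIdem_spec p.monoid_comm).2 m' hm'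
  refine ⟨n * m, p.monoid.mul_mem hn hm, ?_⟩
  rw [mul_smul, hmm, ← mul_smul, hne]
  exact hq'

/-- The elements of the minimal ideal of an irreducible action correspond to the recurrent
states. -/
theorem ncard_recurrentSet_eq_ncard_minIdeal (h : IsIrreducible p.monoid) :
    (recurrentSet p.monoid).ncard = (minIdeal p.monoid).ncard := by
  have hidem := (minIdem_spec p.monoid_comm).1
  set e := minIdem p.monoid with he
  have hemem : e ∈ p.monoid := minIdem_mem
  obtain ⟨q₀⟩ := h.1
  symm
  refine Set.ncard_congr (fun g _ => g • (e • q₀)) ?_ ?_ ?_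
  · rintro _ ⟨m, hm, rfl⟩
    rw [mul_smul]
    exact p.minIdem_smul_mem _
  · rintro _ _ ⟨m, hm, rfl⟩ ⟨m', hm', rfl⟩ hmm
    rw [← he] at hmm ⊢
    -- Every `e • q` is a translate `n • (e • q₀)`. As `n` commutes past `e * k`, the value of `e *
    -- k` at the base point determines it everywhere.
    have key : ∀ k ∈ p.monoid, ∀ n ∈ p.monoid, ∀ q, n • (e • q₀) = e • q →
        (e * k) • q = n • ((e * k) • (e • q₀)) := by
      intro k hk n hn q hq
      rw [← mul_smul n, p.monoid_comm n hn _ (p.monoid.mul_mem hemem hk), mul_smul _ n, hq,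
        ← mul_smul, mul_assoc, p.monoid_comm k hk e hemem, ← mul_assoc, hidem]
    funext q
    obtain ⟨n, hn, hnq⟩ := p.exists_smul_eq h (e • q₀) (p.minIdem_smul_mem q)
    have h1 := key m hm n hn q hnq
    have h2 := key m' hm' n hn q hnq
    rw [hmm, ← h2] at h1
    exact h1
  · intro q hq
    obtain ⟨n, hn, hnq⟩ := p.exists_smul_eq h (e • q₀) hq
    refine ⟨e * n, ⟨n, hn, rfl⟩, ?_⟩
    rw [mul_smul, hnq]
    exact hq

/-! ### The group action on recurrent states -/

variable [Fintype I] [DecidableEq I]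

theorem intAction_single_one (a : I) :
    p.intAction (Pi.single a 1) = Additive.ofMul (p.perm a) := by
  exact (AddMonoidHom.noncommPiCoprod_single _ _ _).trans (by simp)

theorem intAction_count (w : List I) (q : recurrentSet p.monoid) :
    ((p.intAction fun a => (w.count a : ℤ)).toMul q : Q) = runWord p.t w q := by
  induction w generalizing q with
  | nil =>
    have : (fun a : I => (([] : List I).count a : ℤ)) = 0 := by ext; simp
    rw [this, map_zero]
    rfl
  | cons a w ih =>
    rw [Int.count_cons_fun, map_add, intAction_single_one, toMul_add, toMul_ofMul,
      Equiv.Perm.mul_apply, ih]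
    rfl

/-- The action of `ℤ^I` on the recurrent states of an irreducible processor is transitive. -/
theorem exists_intAction_eq (h : IsIrreducible p.monoid) (q q' : recurrentSet p.monoid) :
    ∃ x, (p.intAction x).toMul q = q' := by
  obtain ⟨m, hm, hmq⟩ := p.exists_smul_eq h (q : Q) q'.2
  obtain ⟨w, hw⟩ := p.exists_runWord_of_mem hm
  refine ⟨fun a => (w.count a : ℤ), Subtype.ext ?_⟩
  rw [intAction_count, ← hw, hmq]

/-- Stabilizers of recurrent states in `ℤ^I` act trivially. -/
theorem mem_kernel_of_intAction_eq (h : IsIrreducible p.monoid) {x : I → ℤ}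
    (q : recurrentSet p.monoid) (hx : (p.intAction x).toMul q = q) : x ∈ p.kernel := by
  change p.intAction x = 0
  apply Additive.toMul.injective
  ext q' : 1
  obtain ⟨y, rfl⟩ := p.exists_intAction_eq h q q'
  rw [← Equiv.Perm.mul_apply, ← toMul_add, ← map_add, add_comm, map_add, toMul_add,
    Equiv.Perm.mul_apply, hx]
  rfl

theorem sub_mem_kernel_of_intAction_eq (h : IsIrreducible p.monoid) {x y : I → ℤ}
    (q : recurrentSet p.monoid) (hxy : (p.intAction x).toMul q = (p.intAction y).toMul q) :
    x - y ∈ p.kernel := by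
  apply p.mem_kernel_of_intAction_eq h q
  rw [sub_eq_neg_add, map_add, toMul_add, Equiv.Perm.mul_apply, hxy, ← Equiv.Perm.mul_apply,
    ← toMul_add, ← map_add, neg_add_cancel, map_zero]
  rfl

/-- Words with counts congruent modulo the kernel act alike on recurrent states. -/
theorem sub_mem_kernel_iff (h : IsIrreducible p.monoid) {q : Q} (hq : q ∈ recurrentSet p.monoid)
    (w w' : List I) : ((fun a => (w.count a : ℤ)) - fun a => (w'.count a : ℤ)) ∈ p.kernel ↔
      runWord p.t w q = runWord p.t w' q := by
  rw [← p.intAction_count w ⟨q, hq⟩, ← p.intAction_count w' ⟨q, hq⟩]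
  constructor
  · intro hk
    have : p.intAction (_ - _) = 0 := hk
    rw [map_sub, sub_eq_zero] at this
    rw [this]
  · intro he
    exact p.sub_mem_kernel_of_intAction_eq h ⟨q, hq⟩ (Subtype.ext he)

/-- Applying `e`, which commutes with every word, moves the coincidence to a recurrent state; so `q`
itself need not be recurrent. -/
theorem sub_mem_kernel_of_runWord_eq (h : IsIrreducible p.monoid) {q : Q} {w w' : List I}
    (hww : runWord p.t w q = runWord p.t w' q) :
    ((fun a => (w.count a : ℤ)) - fun a => (w'.count a : ℤ)) ∈ p.kernel := by
  rw [p.sub_mem_kernel_iff h (p.minIdem_smul_mem q), p.runWord_smul minIdem_mem,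
    p.runWord_smul minIdem_mem, hww]

/-- Orbit-stabilizer: the action is transitive and every stabilizer is the whole kernel, so
evaluation at one recurrent state is a bijection from the image of `ℤ^I`. -/
theorem index_kernel (h : IsIrreducible p.monoid) :
    p.kernel.index = (recurrentSet p.monoid).ncard := by
  obtain ⟨q₀⟩ := h.1
  let q₁ : recurrentSet p.monoid := ⟨minIdem p.monoid • q₀, p.minIdem_smul_mem q₀⟩
  rw [kernel, AddSubgroup.index_ker, ← Nat.card_coe_set_eq]
  refine Nat.card_congr (Equiv.ofBijective (fun g => g.1.toMul q₁) ⟨?_, ?_⟩)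
  · rintro ⟨_, x, rfl⟩ ⟨_, y, rfl⟩ hxy
    have hk : p.intAction (x - y) = 0 := p.sub_mem_kernel_of_intAction_eq h q₁ hxy
    rw [map_sub, sub_eq_zero] at hk
    exact Subtype.ext hk
  · intro q
    obtain ⟨x, hx⟩ := p.exists_intAction_eq h q₁ q
    exact ⟨⟨_, x, rfl⟩, hx⟩

end AbelianProcessor

end
noncomputable section

/-! ### Executions of abelian networks -/

namespace AbelianNetwork

open EndAction

variable {V : Type*} {G : Digraph V} {A Q : V → Type*}
variable [∀ v, DecidableEq (A v)] (N : AbelianNetwork G A Q)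

theorem sent_congr (a b : Letter A) {q q' : (v : V) → Q v} (h : q a.1 = q' a.1) :
    N.sent a q b = N.sent a q' b := by
  simp only [sent, h]

variable [DecidableEq V]

/-- The abelian property of the outputs is needed only for the two-letter words `ab` and `ba`. -/
theorem sent_add_sent (v : V) (a b : A v) (q : (v : V) → Q v) (d : Letter A) :
    N.sent ⟨v, a⟩ q d + N.sent ⟨v, b⟩ (Function.update q v ((N.proc v).t a • q v)) d =
      N.sent ⟨v, b⟩ q d + N.sent ⟨v, a⟩ (Function.update q v ((N.proc v).t b • q v)) d := by
  by_cases h : G.Adj v d.1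
  · have := ((N.proc v).o_perm (q v) [a, b] [b, a] (List.Perm.swap _ _ _) ⟨d.1, h⟩).count_eq d.2
    simpa [outputWord, sent, h] using this
  · simp [sent, h]

/-- Letters at one vertex commute by the processor axioms; at distinct vertices neither step sees
the state changed by the other. Counts lie in `ℤ`, so legality plays no role. -/
theorem step_comm (c : Config A Q) (a b : Letter A) :
    N.step (N.step c a) b = N.step (N.step c b) a := by
  obtain ⟨x, q⟩ := c
  obtain ⟨v, a⟩ := a
  obtain ⟨u, b⟩ := b
  rcases eq_or_ne u v with rfl | h
  · refine Prod.ext (funext fun d => ?_) ?_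
    · have := N.sent_add_sent u a b q d
      simp only [step]
      zify at this
      linarith
    · simp only [step, Function.update_self, Function.update_idem]
      rw [← mul_smul, ← mul_smul, (N.proc u).t_comm]
  · refine Prod.ext (funext fun d => ?_) ?_
    · have h1 := N.sent_congr ⟨u, b⟩ d (q := Function.update q v ((N.proc v).t a • q v)) (q' := q)
        (Function.update_of_ne h _ _)
      have h2 := N.sent_congr ⟨v, a⟩ d (q := Function.update q u ((N.proc u).t b • q u)) (q' := q)
        (Function.update_of_ne h.symm _ _)
      simp only [step]
      rw [h1, h2]
      ring
    · simp only [step, Function.update_of_ne h, Function.update_of_ne h.symm]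
      exact Function.update_comm h.symm _ _ _

/-- The result of an execution depends only on the number of letters of each type. -/
theorem exec_perm {w w' : List (Letter A)} (h : w.Perm w') (c : Config A Q) :
    N.exec w c = N.exec w' c :=
  h.foldl_eq' (fun a _ b _ c => N.step_comm c a b) c

theorem exec_cons (a : Letter A) (w : List (Letter A)) (c : Config A Q) :
    N.exec (a :: w) c = N.exec w (N.step c a) := rfl

theorem exec_append (w w' : List (Letter A)) (c : Config A Q) :
    N.exec (w ++ w') c = N.exec w' (N.exec w c) := by
  simp [exec]

/-- The net change of the number of letters of each type in the execution `w` from `q`. -/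
def net (w : List (Letter A)) (q : (v : V) → Q v) : Letter A → ℤ := (N.exec w (0, q)).1

/-- The state reached from `q` by the execution `w`. -/
def run (w : List (Letter A)) (q : (v : V) → Q v) : (v : V) → Q v := (N.exec w (0, q)).2

/-- What is sent depends on the state alone, so extra waiting letters are just carried along. Thus
`net` and `run` describe an execution from any letter count. -/
theorem step_add (x y : Letter A → ℤ) (q : (v : V) → Q v) (a : Letter A) :
    N.step (x + y, q) a = (x + (N.step (y, q) a).1, (N.step (y, q) a).2) := by
  refine Prod.ext (funext fun d => ?_) rfl
  simp only [step, Pi.add_apply]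
  ring

theorem exec_add (w : List (Letter A)) (x y : Letter A → ℤ) (q : (v : V) → Q v) :
    N.exec w (x + y, q) = (x + (N.exec w (y, q)).1, (N.exec w (y, q)).2) := by
  induction w generalizing y q with
  | nil => rfl
  | cons a w ih => rw [exec_cons, step_add, ih, exec_cons]

theorem exec_eq (w : List (Letter A)) (x : Letter A → ℤ) (q : (v : V) → Q v) :
    N.exec w (x, q) = (x + N.net w q, N.run w q) := by
  rw [net, run, ← N.exec_add w x 0 q, add_zero]

theorem net_append (w w' : List (Letter A)) (q : (v : V) → Q v) :
    N.net (w ++ w') q = N.net w q + N.net w' (N.run w q) := by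
  rw [net, exec_append, exec_eq, exec_eq]
  simp

theorem run_append (w w' : List (Letter A)) (q : (v : V) → Q v) :
    N.run (w ++ w') q = N.run w' (N.run w q) := by
  rw [run, exec_append, exec_eq, exec_eq]

theorem net_perm {w w' : List (Letter A)} (h : w.Perm w') (q : (v : V) → Q v) :
    N.net w q = N.net w' q := by
  rw [net, N.exec_perm h, net]

theorem run_cons (a : Letter A) (w : List (Letter A)) (q : (v : V) → Q v) :
    N.run (a :: w) q = N.run w (Function.update q a.1 ((N.proc a.1).t a.2 • q a.1)) := by
  rw [run, exec_cons, step, exec_eq]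

theorem le_exec_add_count (w : List (Letter A)) (c : Config A Q) (b : Letter A) :
    c.1 b ≤ (N.exec w c).1 b + w.count b := by
  induction w generalizing c with
  | nil => simp [exec]
  | cons a w ih =>
    have h := ih (N.step c a)
    rw [exec_cons]
    have h2 : (N.step c a).1 b = c.1 b - (if b = a then 1 else 0) + (N.sent a c.2 b : ℤ) := rfl
    rw [h2] at h
    rcases eq_or_ne b a with rfl | hba
    · simp at h ⊢
      linarith
    · simp [hba, hba.symm] at h ⊢
      linarith

theorem neg_count_le_net (w : List (Letter A)) (q : (v : V) → Q v) (b : Letter A) :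
    -(w.count b : ℤ) ≤ N.net w q b := by
  have := N.le_exec_add_count w (0, q) b
  change (0 : ℤ) ≤ N.net w q b + w.count b at this
  linarith

/-! #### Legal executions -/

theorem legal_append (w w' : List (Letter A)) (c : Config A Q) :
    N.Legal (w ++ w') c ↔ N.Legal w c ∧ N.Legal w' (N.exec w c) := by
  induction w generalizing c with
  | nil => simp [Legal, exec]
  | cons a w ih =>
    rw [List.cons_append, Legal, ih, Legal, exec_cons, and_assoc]

theorem Legal.add {w : List (Letter A)} {y : Letter A → ℤ} {q : (v : V) → Q v}
    (h : N.Legal w (y, q)) {x : Letter A → ℤ} (hx : 0 ≤ x) : N.Legal w (x + y, q) := by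
  induction w generalizing y q with
  | nil => trivial
  | cons a w ih =>
    refine ⟨?_, ?_⟩
    · have h1 : 1 ≤ y a := h.1
      have h2 : 0 ≤ x a := hx a
      change 1 ≤ x a + y a
      omega
    · rw [step_add]
      exact ih h.2

theorem legal_of_count_le (w : List (Letter A)) (c : Config A Q)
    (h : ∀ a, (w.count a : ℤ) ≤ c.1 a) : N.Legal w c := by
  induction w generalizing c with
  | nil => trivial
  | cons a w ih =>
    refine ⟨?_, ih _ fun b => ?_⟩
    · have := h a
      simp at this
      omega
    · have hb := h b
      have h2 : (N.step c a).1 b = c.1 b - (if b = a then 1 else 0) + (N.sent a c.2 b : ℤ) := rfl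
      rw [h2]
      rcases eq_or_ne b a with rfl | hba
      · simp at hb ⊢
        omega
      · simp [hba, hba.symm] at hb ⊢
        omega

theorem Legal.exec_nonneg {w : List (Letter A)} {c : Config A Q} (h : N.Legal w c)
    (hc : 0 ≤ c.1) : 0 ≤ (N.exec w c).1 := by
  induction w generalizing c with
  | nil => exact hc
  | cons a w ih =>
    refine ih h.2 fun b => ?_
    have h1 := h.1
    have hb : 0 ≤ c.1 b := hc b
    change 0 ≤ c.1 b - (if b = a then 1 else 0) + (N.sent a c.2 b : ℤ)
    split_ifs with hba
    · subst hba
      omega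
    · omega

/-- The least action principle. -/
theorem Legal.subperm {w w' : List (Letter A)} {c : Config A Q} (h : N.Legal w c)
    (h' : N.Complete w' c) : w.Subperm w' := by
  induction w generalizing c w' with
  | nil => exact List.nil_subperm
  | cons a w ih =>
    -- If `a` were never processed in `w'`, its initial surplus would survive and `w'` would not be
    -- complete.
    have hmem : a ∈ w' := by
      by_contra hmem
      have h1 := N.le_exec_add_count w' c a
      rw [List.count_eq_zero_of_not_mem hmem] at h1
      have h2 := h' a
      have h3 := h.1
      push_cast at h1
      omega
    have hperm := List.perm_cons_erase hmem
    refine List.Subperm.trans ?_ hperm.symm.subperm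
    rw [List.subperm_cons]
    refine ih h.2 fun b => ?_
    rw [← exec_cons, ← N.exec_perm hperm]
    exact h' b

/-- Least action in both directions; this makes the arbitrary choice in `globalAct` harmless. -/
theorem Legal.perm {w w' : List (Letter A)} {c : Config A Q} (h : N.Legal w c)
    (hc : N.Complete w c) (h' : N.Legal w' c) (hc' : N.Complete w' c) : w.Perm w' :=
  (h.subperm N hc').antisymm (h'.subperm N hc)

theorem globalAct_eq_run {w : List (Letter A)} {x : Letter A → ℕ} {q : (v : V) → Q v}
    (h : N.Legal w (input x q)) (hc : N.Complete w (input x q)) :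
    N.globalAct x q = N.run w q := by
  have hh : N.HaltsOn (input x q) := ⟨w, h, hc⟩
  rw [globalAct, dif_pos hh, N.exec_perm (hh.choose_spec.1.perm N hh.choose_spec.2 h hc), input, exec_eq]

/-- A complete legal execution ends without letters. -/
theorem exists_globalAct_eq (hhalt : N.HaltsOnAllInputs) (x : Letter A → ℕ) (q : (v : V) → Q v) :
    ∃ w, N.Legal w (input x q) ∧ (fun a => (x a : ℤ)) + N.net w q = 0 ∧
      N.globalAct x q = N.run w q := by
  obtain ⟨w, h, hc⟩ := hhalt x q
  refine ⟨w, h, ?_, N.globalAct_eq_run h hc⟩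
  have h0 := h.exec_nonneg N (fun a => Int.natCast_nonneg (x a))
  have hc' : (N.exec w (input x q)).1 ≤ 0 := hc
  rw [input, exec_eq] at h0 hc'
  exact le_antisymm hc' h0

/-- A legal execution of part of the letters extends to a complete one by stabilizing what it leaves
behind. -/
theorem globalAct_eq_globalAct (hhalt : N.HaltsOnAllInputs) {w : List (Letter A)}
    {x y : Letter A → ℕ} {q : (v : V) → Q v} (h : N.Legal w (input x q))
    (hxy : (fun a => (x a : ℤ)) + N.net w q = fun a => (y a : ℤ)) :
    N.globalAct x q = N.globalAct y (N.run w q) := by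
  obtain ⟨w', h', hc'⟩ := hhalt y (N.run w q)
  have he : N.exec w (input x q) = input y (N.run w q) := by
    rw [input, exec_eq, hxy, input]
  rw [N.globalAct_eq_run h' hc', N.globalAct_eq_run (w := w ++ w'), run_append]
  · rw [legal_append, he]
    exact ⟨h, h'⟩
  · intro a
    rw [exec_append, he]
    exact hc' a

/-- Stabilize `y` while the letters `x` wait; exactly `x` remains. -/
theorem globalAct_add (hhalt : N.HaltsOnAllInputs) (x y : Letter A → ℕ) (q : (v : V) → Q v) :
    N.globalAct (x + y) q = N.globalAct x (N.globalAct y q) := by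
  obtain ⟨w, h, hnet, hw⟩ := N.exists_globalAct_eq hhalt y q
  rw [hw]
  have hxy : (fun a => ((x + y) a : ℤ)) = (fun a => (x a : ℤ)) + fun a => (y a : ℤ) := by
    ext; simp
  apply N.globalAct_eq_globalAct hhalt
  · have := h.add N (x := fun a => (x a : ℤ)) (fun a => Int.natCast_nonneg (x a))
    rwa [← hxy] at this
  · rw [hxy, add_assoc, hnet, add_zero]

theorem globalAct_zero (q : (v : V) → Q v) : N.globalAct 0 q = q := by
  rw [N.globalAct_eq_run (w := [])]
  · rfl
  · trivial
  · intro a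
    simp [exec, input]

/-- The global action of a halting network, as a processor without output. -/
def globalProcessor (hhalt : N.HaltsOnAllInputs) :
    AbelianProcessor (Letter A) ((v : V) → Q v) (fun _ : Empty => Empty) where
  t := N.tau
  o := fun _ u => u.elim
  t_comm a b := by
    funext q
    change N.globalAct _ (N.globalAct _ q) = N.globalAct _ (N.globalAct _ q)
    rw [← N.globalAct_add hhalt, ← N.globalAct_add hhalt, add_comm]
  o_perm _ _ _ _ u := u.elim

theorem runWord_tau (hhalt : N.HaltsOnAllInputs) (w : List (Letter A)) (q : (v : V) → Q v) :
    runWord N.tau w q = N.globalAct (fun a => w.count a) q := by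
  induction w generalizing q with
  | nil => exact (N.globalAct_zero q).symm
  | cons a w ih =>
    have h : (fun b => (a :: w).count b) = (fun b => w.count b) + Pi.single a 1 := by
      ext b
      rcases eq_or_ne a b with rfl | hab
      · simp
      · simp [hab]
    rw [h, N.globalAct_add hhalt, ← ih]
    rfl

/-! #### Local words -/

/-- The subword of letters processed at `v`. -/
def localWord (v : V) (w : List (Letter A)) : List (A v) :=
  w.filterMap fun a => if h : a.1 = v then some (h ▸ a.2) else none

theorem run_apply (w : List (Letter A)) (q : (v : V) → Q v) (v : V) :
    N.run w q v = runWord (N.proc v).t (localWord v w) (q v) := by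
  induction w generalizing q with
  | nil => rfl
  | cons a w ih =>
    rw [run_cons, ih]
    obtain ⟨u, a⟩ := a
    rcases eq_or_ne u v with rfl | h
    · simp [localWord, runWord]
    · simp [localWord, h, Function.update_of_ne h.symm]

theorem count_localWord (v : V) (w : List (Letter A)) (a : A v) :
    (localWord v w).count a = w.count ⟨v, a⟩ := by
  induction w with
  | nil => rfl
  | cons b w ih =>
    obtain ⟨u, b⟩ := b
    rcases eq_or_ne u v with rfl | h
    · simp only [localWord] at ih
      rw [List.count_cons, ← ih]
      simp [localWord, List.count_cons]
    · simp only [localWord] at ih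
      have : (⟨u, b⟩ : Letter A) ≠ ⟨v, a⟩ := fun h' => h (congrArg Sigma.fst h')
      rw [List.count_cons_of_ne this, ← ih]
      simp [localWord, h]

variable [Fintype V] [∀ v, Fintype (A v)]

theorem count_wordOf (x : Letter A → ℕ) (a : Letter A) : (wordOf x).count a = x a := by
  rw [wordOf, List.count_flatMap]
  simp [Function.comp_def, List.count_replicate]

/-- Words given locally at each vertex are the local words of an execution. -/
theorem exists_localWord_perm (l : (v : V) → List (A v)) :
    ∃ w : List (Letter A), ∀ v, (localWord v w).Perm (l v) :=
  ⟨wordOf fun a => (l a.1).count a.2, fun v => List.perm_iff_count.2 fun a => by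
    rw [count_localWord, count_wordOf]⟩

/-- The global action of an irreducible halting network is irreducible. -/
theorem isIrreducible_globalProcessor (hirr : N.IsIrreducible) (hhalt : N.HaltsOnAllInputs) :
    EndAction.IsIrreducible (N.globalProcessor hhalt).monoid := by
  refine ⟨⟨fun v => (hirr v).1.some⟩, fun q q' => ?_⟩
  have hloc : ∀ v, ∃ l l' : List (A v),
      runWord (N.proc v).t l (q v) = runWord (N.proc v).t l' (q' v) := by
    intro v
    obtain ⟨m, hm, m', hm', h⟩ := (hirr v).2 (q v) (q' v)
    obtain ⟨l, hl⟩ := (N.proc v).exists_runWord_of_mem hm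
    obtain ⟨l', hl'⟩ := (N.proc v).exists_runWord_of_mem hm'
    exact ⟨l, l', by rw [← hl, ← hl', h]⟩
  choose l l' hl using hloc
  obtain ⟨w, hw⟩ := exists_localWord_perm l
  obtain ⟨w', hw'⟩ := exists_localWord_perm l'
  -- The local irreducibility words, assembled without regard to legality, bring `q` and `q'` to a
  -- common state.
  have hrun : N.run w q = N.run w' q' := by
    funext v
    rw [run_apply, run_apply, (N.proc v).runWord_perm (hw v), (N.proc v).runWord_perm (hw' v), hl]
  have hmem : ∀ x : Letter A → ℕ, ∃ m ∈ (N.globalProcessor hhalt).monoid,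
      ∀ q, m • q = N.globalAct x q := by
    intro x
    have hprod : ∀ u : List (Letter A), ∃ m ∈ (N.globalProcessor hhalt).monoid,
        ∀ q, m • q = runWord N.tau u q := by
      intro u
      induction u with
      | nil => exact ⟨1, one_mem _, fun q => rfl⟩
      | cons a u ih =>
        obtain ⟨m, hm, hmq⟩ := ih
        refine ⟨m * N.tau a, mul_mem hm ((N.globalProcessor hhalt).t_mem a), fun q => ?_⟩
        rw [mul_smul, hmq]
        rfl
    obtain ⟨m, hm, hmq⟩ := hprod (wordOf x)
    refine ⟨m, hm, fun q => ?_⟩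
    rw [hmq, N.runWord_tau hhalt]
    simp only [count_wordOf]
  have hnat : ∀ (u : List (Letter A)) (q : (v : V) → Q v), ∃ y : Letter A → ℕ,
      (fun a => (u.count a : ℤ)) + N.net u q = fun a => (y a : ℤ) := by
    intro u q
    refine ⟨fun a => (u.count a + N.net u q a).toNat, funext fun a => ?_⟩
    have := N.neg_count_le_net u q a
    simp only [Pi.add_apply]
    rw [Int.toNat_of_nonneg (by omega)]
  obtain ⟨y, hy⟩ := hnat w q
  obtain ⟨y', hy'⟩ := hnat w' q'
  have key : ∀ (u : List (Letter A)) (q : (v : V) → Q v) (y z : Letter A → ℕ),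
      ((fun a => (u.count a : ℤ)) + N.net u q = fun a => (y a : ℤ)) →
      N.globalAct (z + fun a => u.count a) q = N.globalAct (z + y) (N.run u q) := by
    intro u q y z hy
    apply N.globalAct_eq_globalAct hhalt
    · apply N.legal_of_count_le
      intro a
      simp [input]
    · funext a
      have := congrFun hy a
      simp only [Pi.add_apply, Nat.cast_add] at this ⊢
      linarith
  obtain ⟨m, hm, hmq⟩ := hmem (y' + fun a => w.count a)
  obtain ⟨m', hm', hmq'⟩ := hmem (y + fun a => w'.count a)
  refine ⟨m, hm, m', hm', ?_⟩
  rw [hmq, hmq', key w q y y' hy, key w' q' y' y hy', hrun, add_comm]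

end AbelianNetwork

end
noncomputable section

/-! ### The Laplacian lattice -/

namespace AbelianNetwork

open EndAction

variable {V : Type*} {G : Digraph V} {A Q : V → Type*}
/-- The inclusion `ℤ^A → ℚ^A`. -/
def castQ (A : V → Type*) : (Letter A → ℤ) →+ (Letter A → ℚ) :=
  (Int.castAddHom ℚ).compLeft (Letter A)

theorem castQ_apply (x : Letter A → ℤ) (a : Letter A) : castQ A x a = (x a : ℚ) := rfl

theorem castQ_injective : Function.Injective (castQ A) := fun x y h => by
  ext a
  exact Int.cast_injective (α := ℚ) (congrFun h a)

variable [DecidableEq V] [∀ v, DecidableEq (A v)]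

/-- The vector in `ℤ^A` that counts the letters of a word. -/
abbrev intCount (w : List (Letter A)) : Letter A → ℤ := fun a => (w.count a : ℤ)

theorem intCount_append (w w' : List (Letter A)) :
    intCount (w ++ w') = intCount w + intCount w' := by
  ext a
  simp [intCount]

theorem intCount_replicate (n : ℕ) (a : Letter A) :
    intCount (List.replicate n a) = Pi.single a (n : ℤ) := by
  ext b
  rcases eq_or_ne a b with rfl | h
  · simp
  · simp [List.count_replicate, h]

theorem perm_of_intCount_eq {w w' : List (Letter A)} (h : intCount w = intCount w') :
    w.Perm w' :=
  List.perm_iff_count.2 fun a => by exact_mod_cast congrFun h a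

variable [∀ v, Fintype (A v)] [∀ v, Finite (Q v)] {N : AbelianNetwork G A Q} {q : (v : V) → Q v}

theorem intCount_sub_mem_iff (hirr : N.IsIrreducible) (hq : N.IsLocallyRecurrent q)
    (w w' : List (Letter A)) :
    intCount w - intCount w' ∈ N.totalKernel ↔ N.run w q = N.run w' q := by
  rw [totalKernel, AddSubgroup.mem_iInf, funext_iff]
  refine forall_congr' fun v => ?_
  rw [AddSubgroup.mem_comap, run_apply, run_apply,
    ← (N.proc v).sub_mem_kernel_iff (hirr v) (hq v)]
  simp only [count_localWord]
  rfl

theorem run_eq_of_mem (hirr : N.IsIrreducible) (hq : N.IsLocallyRecurrent q)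
    {w : List (Letter A)} (hw : intCount w ∈ N.totalKernel) : N.run w q = q := by
  have h0 : intCount ([] : List (Letter A)) = 0 := by ext; simp
  have h := (intCount_sub_mem_iff hirr hq w []).1 (by rwa [h0, sub_zero])
  exact h

/-- The first word restores `q`, so the second starts from `q` again. This is the source of the
linearity of `P`. -/
theorem net_append_of_mem (hirr : N.IsIrreducible) (hq : N.IsLocallyRecurrent q)
    {w : List (Letter A)} (hw : intCount w ∈ N.totalKernel) (w' : List (Letter A)) :
    N.net (w ++ w') q = N.net w q + N.net w' q := by
  rw [net_append, run_eq_of_mem hirr hq hw]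

variable [Fintype V]

theorem intCount_wordOf (x : Letter A → ℕ) : intCount (wordOf x) = fun a => (x a : ℤ) := by
  ext a
  simp [count_wordOf]

theorem exists_intCount_sub (x : Letter A → ℤ) :
    ∃ u u' : List (Letter A), x = intCount u - intCount u' := by
  refine ⟨wordOf fun a => (x a).toNat, wordOf fun a => (-x a).toNat, ?_⟩
  rw [intCount_wordOf, intCount_wordOf]
  ext a
  simp only [Pi.sub_apply]
  omega

variable (N)

theorem mul_resetNumber_mem (c : Letter A → ℤ) :
    (fun a => c a * N.resetNumber a) ∈ N.totalKernel := by
  have h : (fun a => c a * (N.resetNumber a : ℤ)) =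
      ∑ a, c a • (Pi.single a (N.resetNumber a : ℤ) : Letter A → ℤ) := by
    ext b
    rw [Finset.sum_apply, Finset.sum_eq_single b]
    · simp
    · intro a _ hab
      simp [Pi.single_eq_of_ne hab.symm]
    · simp
  rw [h]
  exact AddSubgroup.sum_mem _ fun a _ => AddSubgroup.zsmul_mem _ (N.resetNumber_spec a).2 _

theorem mem_rectLattice {x : Letter A → ℤ} :
    x ∈ N.rectLattice ↔ ∃ c : Letter A → ℤ, x = fun a => c a * N.resetNumber a := by
  constructor
  · rintro ⟨c, rfl⟩
    refine ⟨c, funext fun a => ?_⟩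
    change (Matrix.diagonal (fun a : Letter A => (N.resetNumber a : ℤ))).mulVec c a = _
    rw [Matrix.mulVec_diagonal, mul_comm]
  · rintro ⟨c, rfl⟩
    refine ⟨c, funext fun a => ?_⟩
    change (Matrix.diagonal (fun a : Letter A => (N.resetNumber a : ℤ))).mulVec c a = _
    rw [Matrix.mulVec_diagonal, mul_comm]

theorem rectLattice_le : N.rectLattice ≤ N.totalKernel := by
  intro x hx
  obtain ⟨c, rfl⟩ := N.mem_rectLattice.1 hx
  exact N.mul_resetNumber_mem c

/-- Every element of the total kernel is a difference of nonnegative elements. -/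
theorem exists_intCount_sub_of_mem {k : Letter A → ℤ} (hk : k ∈ N.totalKernel) :
    ∃ u u' : List (Letter A), intCount u ∈ N.totalKernel ∧ intCount u' ∈ N.totalKernel ∧
      k = intCount u - intCount u' := by
  -- Adding `|k a| * r_a` stays in `K` and makes `k` nonnegative, because `r_a ≥ 1`.
  have hd := N.mul_resetNumber_mem fun a => |k a|
  have h1 : intCount (wordOf fun a => (k a).natAbs * N.resetNumber a) =
      fun a => |k a| * (N.resetNumber a : ℤ) := by
    rw [intCount_wordOf]
    ext a
    simp
  have h2 : intCount (wordOf fun a => (k a + |k a| * N.resetNumber a).toNat) =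
      k + fun a => |k a| * (N.resetNumber a : ℤ) := by
    rw [intCount_wordOf]
    ext a
    have hr : (1 : ℤ) ≤ N.resetNumber a := by exact_mod_cast (N.resetNumber_spec a).1
    have : -|k a| ≤ k a := neg_abs_le _
    have h3 : |k a| * 1 ≤ |k a| * (N.resetNumber a : ℤ) :=
      mul_le_mul_of_nonneg_left hr (abs_nonneg _)
    simp only [Pi.add_apply]
    exact Int.toNat_of_nonneg (by linarith)
  refine ⟨wordOf fun a => (k a + |k a| * N.resetNumber a).toNat,
    wordOf fun a => (k a).natAbs * N.resetNumber a, ?_, ?_, ?_⟩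
  · rw [h2]
    exact add_mem hk hd
  · rw [h1]
    exact hd
  · rw [h2, h1, add_sub_cancel_right]

/-! ### Linearity of production on the total kernel -/

variable {N}

-- Column `a` of `L` is the net loss of letters when `r_a` letters `a` are processed, hence
-- integral.
variable (N) in
theorem one_sub_productionMatrix_mul (q : (v : V) → Q v) (b a : Letter A) :
    (1 - N.productionMatrix q) b a * (N.resetNumber a : ℚ) =
      -(N.net (List.replicate (N.resetNumber a) a) q b : ℚ) := by
  have hr : (N.resetNumber a : ℚ) ≠ 0 := by
    have := (N.resetNumber_spec a).1
    positivity
  have hperm : (wordOf (Pi.single a (N.resetNumber a))).Perm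
      (List.replicate (N.resetNumber a) a) := by
    apply perm_of_intCount_eq
    rw [intCount_wordOf, intCount_replicate]
    ext b
    rcases eq_or_ne a b with rfl | h
    · simp
    · simp [Pi.single_eq_of_ne h.symm]
  have hprod : N.production q (Pi.single a (N.resetNumber a)) b =
      (Pi.single a (N.resetNumber a) : Letter A → ℕ) b +
        N.net (List.replicate (N.resetNumber a) a) q b := by
    rw [production, localAct, N.exec_perm hperm, input, exec_eq]
    rfl
  rw [Matrix.sub_apply, productionMatrix, Matrix.of_apply, hprod]
  push_cast
  rcases eq_or_ne a b with rfl | h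
  · rw [Matrix.one_apply_eq, Pi.single_eq_same]
    field_simp
    ring
  · rw [Matrix.one_apply_ne h.symm, Pi.single_eq_of_ne h.symm]
    push_cast
    field_simp
    ring

variable (N) in
/-- The Laplacian as an integer matrix. -/
def intLaplacian (q : (v : V) → Q v) : Matrix (Letter A) (Letter A) ℤ :=
  Matrix.of fun b a => -N.net (List.replicate (N.resetNumber a) a) q b

variable (N) in
theorem laplacian_eq_map (q : (v : V) → Q v) :
    N.laplacian q = (N.intLaplacian q).map (Int.castRingHom ℚ) := by
  ext b a
  rw [laplacian, Matrix.mul_diagonal, one_sub_productionMatrix_mul, intLaplacian]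
  simp

variable (N) in
/-- The map `k ↦ (I - P) k`. -/
def oneSubProd (q : (v : V) → Q v) : (Letter A → ℤ) →+ (Letter A → ℚ) :=
  (1 - N.productionMatrix q).mulVecLin.toAddMonoidHom.comp (castQ A)

variable (N) in
theorem oneSubProd_apply (q : (v : V) → Q v) (x : Letter A → ℤ) :
    N.oneSubProd q x = (1 - N.productionMatrix q).mulVec (castQ A x) := rfl

variable (N) in
theorem oneSubProd_mul_resetNumber (q : (v : V) → Q v) (c : Letter A → ℤ) :
    N.oneSubProd q (fun a => c a * N.resetNumber a) =
      castQ A ((N.intLaplacian q).mulVec c) := by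
  ext b
  rw [oneSubProd_apply, castQ_apply, Matrix.mulVec, Matrix.mulVec, dotProduct, dotProduct]
  push_cast
  refine Finset.sum_congr rfl fun a _ => ?_
  have h := N.one_sub_productionMatrix_mul q b a
  rw [castQ_apply, intLaplacian, Matrix.of_apply]
  push_cast
  rw [← h]
  ring

variable (N) in
theorem castQ_net_replicate (q : (v : V) → Q v) (a : Letter A) :
    castQ A (N.net (List.replicate (N.resetNumber a) a) q) =
      -N.oneSubProd q (intCount (List.replicate (N.resetNumber a) a)) := by
  have h : intCount (List.replicate (N.resetNumber a) a) =
      fun b => (Pi.single a 1 : Letter A → ℤ) b * N.resetNumber b := by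
    rw [intCount_replicate]
    ext b
    rcases eq_or_ne a b with rfl | h
    · simp
    · simp [Pi.single_eq_of_ne h.symm]
  rw [h, oneSubProd_mul_resetNumber, Matrix.mulVec_single_one, ← map_neg]
  congr 1
  ext b
  simp [intLaplacian]

/-- The letters passed when an element of the rectangular lattice is processed. -/
theorem castQ_net_wordOf_mul (hirr : N.IsIrreducible) (hq : N.IsLocallyRecurrent q)
    (c : Letter A → ℕ) :
    castQ A (N.net (wordOf fun a => c a * N.resetNumber a) q) =
      -N.oneSubProd q (intCount (wordOf fun a => c a * N.resetNumber a)) := by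
  have hmem0 : intCount ([] : List (Letter A)) = 0 := by ext; simp
  have hnet0 : N.net [] q = 0 := rfl
  have hrep : ∀ (a : Letter A) (n : ℕ),
      intCount (List.replicate (n * N.resetNumber a) a) ∈ N.totalKernel ∧
      castQ A (N.net (List.replicate (n * N.resetNumber a) a) q) =
        -N.oneSubProd q (intCount (List.replicate (n * N.resetNumber a) a)) := by
    intro a n
    induction n with
    | zero => simp only [zero_mul, List.replicate_zero, hmem0, hnet0, map_zero, neg_zero,
        zero_mem, and_self]
    | succ n ih =>
      have h1 : intCount (List.replicate (N.resetNumber a) a) ∈ N.totalKernel := by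
        rw [intCount_replicate]
        exact (N.resetNumber_spec a).2
      rw [add_mul, one_mul, List.replicate_add, intCount_append,
        net_append_of_mem hirr hq ih.1]
      refine ⟨add_mem ih.1 h1, ?_⟩
      rw [map_add, map_add, ih.2, castQ_net_replicate, neg_add]
  have hflat : ∀ l : List (Letter A),
      castQ A (N.net (l.flatMap fun a => List.replicate (c a * N.resetNumber a) a) q) =
        -N.oneSubProd q (intCount (l.flatMap fun a =>
          List.replicate (c a * N.resetNumber a) a)) := by
    intro l
    induction l with
    | nil => simp only [List.flatMap_nil, hmem0, hnet0, map_zero, neg_zero]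
    | cons a l ih =>
      rw [List.flatMap_cons, intCount_append, net_append_of_mem hirr hq (hrep a _).1,
        map_add, map_add, ih, (hrep a _).2, neg_add]
  exact hflat _

/-- The letters passed when an element of the total kernel is processed. -/
theorem castQ_net_of_mem (hirr : N.IsIrreducible) (hq : N.IsLocallyRecurrent q)
    {w : List (Letter A)} (hw : intCount w ∈ N.totalKernel) :
    castQ A (N.net w q) = -N.oneSubProd q (intCount w) := by
  have hrep : ∀ n : ℕ, intCount (List.replicate n w).flatten = n • intCount w ∧
      N.net (List.replicate n w).flatten q = n • N.net w q := by
    intro n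
    induction n with
    | zero =>
      refine ⟨?_, ?_⟩
      · ext; simp
      · rw [zero_smul]; rfl
    | succ n ih =>
      rw [List.replicate_succ, List.flatten_cons, intCount_append,
        net_append_of_mem hirr hq hw, ih.1, ih.2, succ_nsmul', succ_nsmul']
      exact ⟨rfl, rfl⟩
  -- Repeating `w` a total of `R` times lands in the rectangular lattice, where the formula is
  -- known; then `R` is cancelled over `ℚ`.
  set R : ℕ := ∏ a, N.resetNumber a with hR
  have hR0 : R ≠ 0 := Finset.prod_ne_zero_iff.2 fun a _ => by
    have := (N.resetNumber_spec a).1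
    omega
  have hperm : (List.replicate R w).flatten.Perm
      (wordOf fun a => (w.count a * (R / N.resetNumber a)) * N.resetNumber a) := by
    apply perm_of_intCount_eq
    rw [(hrep R).1, intCount_wordOf]
    ext a
    have hdvd : N.resetNumber a ∣ R := Finset.dvd_prod_of_mem _ (Finset.mem_univ a)
    rw [mul_assoc, Nat.div_mul_cancel hdvd, Pi.smul_apply, nsmul_eq_mul, Nat.cast_mul, mul_comm]
  have h := castQ_net_wordOf_mul hirr hq fun a => w.count a * (R / N.resetNumber a)
  have hcount : intCount (wordOf fun a => (w.count a * (R / N.resetNumber a)) * N.resetNumber a) =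
      R • intCount w := by
    rw [← (hrep R).1]
    ext a
    simp only [intCount, hperm.count_eq]
  rw [← N.net_perm hperm, hcount, (hrep R).2, map_nsmul, map_nsmul, ← smul_neg] at h
  ext a
  have ha := congrFun h a
  simp only [Pi.smul_apply, nsmul_eq_mul] at ha
  exact mul_left_cancel₀ (Nat.cast_ne_zero.2 hR0) ha

/-- Let the input with `r_a` letters of each type `a` halt, and divide its letter counts with
remainder as `Dc + s` with `s_a < r_a`. The part `Dc` restores `q`, so `Lc = r + net(s) ≥ r - s >
0`. -/
theorem det_intLaplacian_pos (hirr : N.IsIrreducible) (hhalt : N.HaltsOnAllInputs)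
    (hq : N.IsLocallyRecurrent q) : 0 < (N.intLaplacian q).det := by
  obtain ⟨w, -, hnet, -⟩ := N.exists_globalAct_eq hhalt N.resetNumber q
  set c : Letter A → ℕ := fun a => w.count a / N.resetNumber a
  set s : Letter A → ℕ := fun a => w.count a % N.resetNumber a with hs
  have hperm : w.Perm ((wordOf fun a => c a * N.resetNumber a) ++ wordOf s) := by
    apply perm_of_intCount_eq
    rw [intCount_append, intCount_wordOf, intCount_wordOf]
    ext a
    have := Nat.div_add_mod' (w.count a) (N.resetNumber a)
    simp only [Pi.add_apply]
    exact_mod_cast this.symm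
  have hmem : intCount (wordOf fun a => c a * N.resetNumber a) ∈ N.totalKernel := by
    rw [intCount_wordOf]
    have := N.mul_resetNumber_mem fun a => (c a : ℤ)
    simpa using this
  have hTc : (N.intLaplacian q).mulVec (fun a => (c a : ℤ)) =
      (fun a => (N.resetNumber a : ℤ)) + N.net (wordOf s) q := by
    have h1 := castQ_net_wordOf_mul hirr hq c
    have h2 : intCount (wordOf fun a => c a * N.resetNumber a) =
        fun a => (c a : ℤ) * N.resetNumber a := by
      rw [intCount_wordOf]
      ext
      simp
    rw [h2, oneSubProd_mul_resetNumber, ← map_neg] at h1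
    have h3 := castQ_injective h1
    rw [N.net_perm hperm, net_append_of_mem hirr hq hmem, h3] at hnet
    rw [← sub_eq_zero, ← neg_eq_zero, ← hnet]
    abel
  have hpos : ∀ a, 0 < (N.intLaplacian q).mulVec (fun a => (c a : ℤ)) a := by
    intro a
    rw [hTc, Pi.add_apply]
    have h1 := N.neg_count_le_net (wordOf s) q a
    rw [count_wordOf] at h1
    have h2 : s a < N.resetNumber a := Nat.mod_lt _ (N.resetNumber_spec a).1
    have h3 : (s a : ℤ) < N.resetNumber a := by exact_mod_cast h2
    linarith
  have hdet : 0 < ((N.intLaplacian q).map (Int.castRingHom ℝ)).det := by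
    refine Matrix.det_pos_of_mulVec_pos _ ?_ (fun a => (c a : ℝ)) (fun a => Nat.cast_nonneg _) ?_
    · intro b a hba
      have h1 := N.neg_count_le_net (List.replicate (N.resetNumber a) a) q b
      rw [List.count_replicate, if_neg (by simpa using hba.symm)] at h1
      rw [Matrix.map_apply, intLaplacian, Matrix.of_apply]
      simp only [Int.coe_castRingHom, Int.cast_nonpos]
      push_cast at h1
      linarith
    · intro a
      have h := hpos a
      have h' : ((N.intLaplacian q).map (Int.castRingHom ℝ)).mulVec (fun a => (c a : ℝ)) a =
          (((N.intLaplacian q).mulVec (fun a => (c a : ℤ)) a : ℤ) : ℝ) := by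
        simp [Matrix.mulVec, dotProduct]
      rw [h']
      exact_mod_cast h
  rw [← RingHom.mapMatrix_apply, ← RingHom.map_det] at hdet
  simpa using hdet

/-! ### Comparison of the total and global kernels -/

/-- The image of the total kernel under `I - P` is the kernel of the global action. -/
theorem map_kernel_globalProcessor (hirr : N.IsIrreducible) (hhalt : N.HaltsOnAllInputs)
    (hq : N.IsLocallyRecurrent q) :
    (N.globalProcessor hhalt).kernel.map (castQ A) = N.totalKernel.map (N.oneSubProd q) := by
  have hgirr := N.isIrreducible_globalProcessor hirr hhalt
  apply le_antisymm
  · rintro _ ⟨x, hx, rfl⟩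
    obtain ⟨u, u', rfl⟩ := exists_intCount_sub x
    -- The state `q` is only locally recurrent; the prefix `z`, which acts as `e`, makes it globally
    -- recurrent.
    obtain ⟨z, hz⟩ := (N.globalProcessor hhalt).exists_runWord_of_mem minIdem_mem
    have hrec := (N.globalProcessor hhalt).minIdem_smul_mem q
    have huu := ((N.globalProcessor hhalt).sub_mem_kernel_iff hgirr hrec u u').1 hx
    rw [hz] at huu
    have huu' : runWord N.tau (z ++ u) q = runWord N.tau (z ++ u') q := by
      rw [runWord, runWord, List.foldl_append, List.foldl_append]
      exact huu
    rw [N.runWord_tau hhalt, N.runWord_tau hhalt] at huu'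
    obtain ⟨w, -, hnet, hw⟩ := N.exists_globalAct_eq hhalt (fun a => (z ++ u).count a) q
    obtain ⟨w', -, hnet', hw'⟩ := N.exists_globalAct_eq hhalt (fun a => (z ++ u').count a) q
    rw [hw, hw'] at huu'
    have hk := (intCount_sub_mem_iff hirr hq w w').2 huu'
    obtain ⟨k, k', hkm, hkm', hkk⟩ := N.exists_intCount_sub_of_mem hk
    -- Only the difference of `w` and `w'` lies in `K`. Prefixing kernel words that restore `q`
    -- expresses the difference of their nets through `k` and `k'`.
    have hperm : (k' ++ w).Perm (k ++ w') := by
      apply perm_of_intCount_eq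
      rw [intCount_append, intCount_append]
      rw [sub_eq_sub_iff_add_eq_add] at hkk
      rw [add_comm, hkk]
    have hn := N.net_perm hperm q
    rw [net_append_of_mem hirr hq hkm', net_append_of_mem hirr hq hkm] at hn
    refine ⟨_, hk, ?_⟩
    rw [hkk, map_sub]
    have h1 := castQ_net_of_mem hirr hq hkm
    have h2 := castQ_net_of_mem hirr hq hkm'
    have h3 : intCount u - intCount u' = N.net k' q - N.net k q := by
      change intCount (z ++ u) + _ = 0 at hnet
      change intCount (z ++ u') + _ = 0 at hnet'
      rw [intCount_append] at hnet hnet'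
      have h4 : intCount u - intCount u' = N.net w' q - N.net w q := by
        rw [← sub_eq_zero, ← sub_self (0 : Letter A → ℤ)]
        nth_rw 2 [← hnet']
        rw [← hnet]
        abel
      rw [h4, sub_eq_sub_iff_add_eq_add, add_comm, ← hn]
    rw [h3, map_sub, h1, h2]
    abel
  · rintro _ ⟨k, hk, rfl⟩
    obtain ⟨w, w', hw, hw', rfl⟩ := N.exists_intCount_sub_of_mem hk
    -- Starting from exactly the letters of `w`, running `w` is legal, returns to `q` and leaves
    -- `Pk`. So `k` and `Pk` act alike at `q`, and `k - Pk = -net w` lies in the global kernel.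
    have key : ∀ w : List (Letter A), intCount w ∈ N.totalKernel →
        N.oneSubProd q (intCount w) ∈ (N.globalProcessor hhalt).kernel.map (castQ A) := by
      intro w hw
      refine ⟨-N.net w q, ?_, by rw [map_neg, castQ_net_of_mem hirr hq hw, neg_neg]⟩
      have hy : intCount w + N.net w q =
          fun a => (((w.count a : ℤ) + N.net w q a).toNat : ℤ) := by
        ext a
        have := N.neg_count_le_net w q a
        simp only [Pi.add_apply]
        rw [Int.toNat_of_nonneg (by omega)]
      have hact := N.globalAct_eq_globalAct hhalt
        (N.legal_of_count_le w (input (fun a => w.count a) q) fun a => le_rfl) hy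
      rw [run_eq_of_mem hirr hq hw, ← N.runWord_tau hhalt] at hact
      have hact' : runWord N.tau w q = runWord N.tau
          (wordOf fun a => ((w.count a : ℤ) + N.net w q a).toNat) q := by
        rw [hact, N.runWord_tau hhalt]
        simp only [count_wordOf]
      have := (N.globalProcessor hhalt).sub_mem_kernel_of_runWord_eq hgirr hact'
      simp only [count_wordOf] at this
      rw [← hy] at this
      simpa using this
    rw [map_sub]
    exact sub_mem (key w hw) (key w' hw')

/-- Multiplicativity of the index along `Lℤ^A ≤ (I - P)K ≤ ℤ^A`. As `I - P` is rational, the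
lattices are compared inside `ℚ^A`. -/
theorem iota_mul_index_kernel (hirr : N.IsIrreducible) (hhalt : N.HaltsOnAllInputs)
    (hq : N.IsLocallyRecurrent q) :
    (N.iota * (N.globalProcessor hhalt).kernel.index : ℤ) = (N.intLaplacian q).det := by
  have hdet := det_intLaplacian_pos hirr hhalt hq
  have hinj : Function.Injective (N.oneSubProd q) := by
    refine Function.Injective.comp (g := (1 - N.productionMatrix q).mulVec) ?_ castQ_injective
    have hne : (N.laplacian q).det ≠ 0 := by
      rw [laplacian_eq_map, ← RingHom.mapMatrix_apply, ← RingHom.map_det]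
      simpa using hdet.ne'
    rw [laplacian, Matrix.det_mul] at hne
    exact Matrix.mulVec_injective_of_isUnit
      ((Matrix.isUnit_iff_isUnit_det _).2 (left_ne_zero_of_mul hne).isUnit)
  set Λ := (LinearMap.range (N.intLaplacian q).mulVecLin).toAddSubgroup with hΛ
  have hmap : N.rectLattice.map (N.oneSubProd q) = Λ.map (castQ A) := by
    ext y
    constructor
    · rintro ⟨x, hx, rfl⟩
      obtain ⟨c, rfl⟩ := N.mem_rectLattice.1 hx
      exact ⟨_, ⟨c, rfl⟩, (N.oneSubProd_mul_resetNumber q c).symm⟩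
    · rintro ⟨_, ⟨c, rfl⟩, rfl⟩
      exact ⟨_, N.mem_rectLattice.2 ⟨c, rfl⟩, N.oneSubProd_mul_resetNumber q c⟩
  have hker := map_kernel_globalProcessor hirr hhalt hq
  have hle : Λ ≤ (N.globalProcessor hhalt).kernel := by
    rw [← AddSubgroup.map_le_map_iff_of_injective castQ_injective, ← hmap, hker]
    exact AddSubgroup.map_mono N.rectLattice_le
  have hrel : N.iota = Λ.relIndex (N.globalProcessor hhalt).kernel := by
    rw [iota, ← AddSubgroup.relIndex_map_map_of_injective _ _ hinj, hmap, ← hker,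
      AddSubgroup.relIndex_map_map_of_injective _ _ castQ_injective]
  have h := AddSubgroup.relIndex_mul_index hle
  rw [← hrel, hΛ, Matrix.index_range_mulVecLin _ hdet.ne'] at h
  have h' : ((N.iota * (N.globalProcessor hhalt).kernel.index : ℕ) : ℤ) = _ := congrArg _ h
  rw [Int.natAbs_of_nonneg hdet.le] at h'
  exact_mod_cast h'

end AbelianNetwork

end

theorem theorem3p19 {V : Type*} [Fintype V] [DecidableEq V] (G : Digraph V) (A Q : V → Type*)
    [∀ v, Fintype (A v)] [∀ v, DecidableEq (A v)] [∀ v, Finite (Q v)]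
    (N : AbelianNetwork G A Q) (hirr : N.IsIrreducible) (hhalt : N.HaltsOnAllInputs) :
    N.Rec.ncard = N.Crit.ncard ∧
      ∀ q : (v : V) → Q v, N.IsLocallyRecurrent q →
        (N.Crit.ncard : ℚ) = (N.laplacian q).det / (N.iota : ℚ) := by
  have hgirr := N.isIrreducible_globalProcessor hirr hhalt
  have hcard : N.Rec.ncard = N.Crit.ncard :=
    (N.globalProcessor hhalt).ncard_recurrentSet_eq_ncard_minIdeal hgirr
  refine ⟨hcard, fun q hq => ?_⟩
  have hindex : (N.globalProcessor hhalt).kernel.index = N.Rec.ncard :=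
    (N.globalProcessor hhalt).index_kernel hgirr
  have h := AbelianNetwork.iota_mul_index_kernel hirr hhalt hq
  have hdet := AbelianNetwork.det_intLaplacian_pos hirr hhalt hq
  -- A zero here would be the convention for infinite index; it is excluded by `ι · #Rec = det L >
  -- 0`.
  have hi : (N.iota : ℚ) ≠ 0 := by
    intro h0
    rw [Nat.cast_eq_zero.1 h0] at h
    simp at h
    omega
  have hlap : (N.laplacian q).det = ((N.intLaplacian q).det : ℚ) := by
    rw [N.laplacian_eq_map, ← RingHom.mapMatrix_apply, ← RingHom.map_det]
    rfl
  rw [hindex, hcard] at h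
  rw [hlap, ← h, eq_div_iff hi]
  push_cast
  ring
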